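/- For $N\ge 1$ let $\mathcal S=\mathbb R^N$, $M[\phi]=\sum_{x=1}^N\phi_x$, $N[\phi]=\sum_{x=1}^N\phi_x^2$, and let $U:\mathbb R^N\to\mathbb R\times\mathbb R^{N-1}$ be any orthogonal map with $(U\phi)_1=N^{-1/2}\sum_x\phi_x$. For $\rho>0$ and $m\in(-\sqrt\rho,\sqrt\rho)$ (and $N\ge 2$) the auxiliary microcanonical ensemble is the probability measure on $\mathbb R^N$ with expectation $$\langle g\rangle_{\mathrm{MC}}^{m,\rho;N}=\frac1{|\mathbb S^{N-2}|}\int_{\mathbb S^{N-2}}d\Omega\;(g\circ U^{-1})\bigl(m\sqrt N,\ \sqrt{N(\rho-m^2)}\,\Omega\bigr),$$ and for $\mu\in\mathbb R$, $\eta>0$ the auxiliary grand canonical ensemble is the probability measure on $\mathbb R^N$ with expectation $$\langle g\rangle_{\mathrm{GC}}^{\mu,\eta;N}=\frac{\int_{\mathbb R^N}e^{-\mu M[\phi]-\eta N[\phi]}g(\phi)\,d\phi}{\int_{\mathbb R^N}e^{-\mu M[\phi]-\eta N[\phi]}\,d\phi}.$$ For $I\subset\{1,\dots,N\}$ with $|I|=n$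 let $P_I:\mathbb R^N\to\mathbb R^n$ be the projection onto the coordinates in $I$, listed in increasing order. Theorem. Let $\rho>0$, $m\in(-\sqrt\rho,\sqrt\rho)$, $\mu:=-\frac{m}{\rho-m^2}$ and $\eta:=\frac1{2(\rho-m^2)}$. Let $n\ge 0$ be fixed and let $f:\mathbb R^n\to\mathbb R$ be either a bounded function which is $1$-Lipschitz with respect to the Euclidean norm $\|\cdot\|_2$, or a moment $f(y)=\prod_{i=1}^n y_i^{k_i}$ with $k_1,\dots,k_n\in\{0,1,2,\dots\}$. Then there are $C$ and $N_0$, which may depend on $\rho,m,n,f$, such that for all $N\ge N_0$, all $U$ as above and all $I\subset\{1,\dots,N\}$ with $|I|=n$, the function $f\circ P_I$ is integrable with respect to both ensembles and $$\Bigl|\langle f\circ P_I\rangle_{\mathrm{MC}}^{m,\rho;N}-\langle f\circ P_I\rangle_{\mathrm{GC}}^{\mu,\eta;N}\Bigr|\le C\,N^{-1/2}.$$ -/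

import Mathlib

open MeasureTheory

noncomputable section

namespace SphericalModel

/-- The space of field configurations `ℝ^Λ` on the lattice `Λ = [N]`, with the Euclidean norm and
Lebesgue measure. -/
abbrev Config (N : ℕ) : Type := EuclideanSpace ℝ (Fin N)

/-- The magnetization `M[φ] = ∑ₓ φ(x)`. -/
def magnetization {N : ℕ} (φ : Config N) : ℝ := ∑ x, φ x

/-- The particle number `N[φ] = ∑ₓ φ(x)²`. -/
def particleNumber {N : ℕ} (φ : Config N) : ℝ := ∑ x, φ x ^ 2

/-- The range `ℝ × ℝ^{N-1}` of the orthogonal change of variables, with its Euclidean norm. -/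
abbrev Split (N : ℕ) : Type := WithLp 2 (ℝ × EuclideanSpace ℝ (Fin (N - 1)))

/-- The orthogonal map `U : ℝ^N → ℝ × ℝ^{N-1}` has first coordinate
`(U φ)₁ = N^{-1/2} ∑ₓ φ(x)`. (Being orthogonal, it then diagonalizes the all-ones matrix.) -/
def IsMagnetizationFrame {N : ℕ} (U : Config N ≃ₗᵢ[ℝ] Split N) : Prop :=
  ∀ φ : Config N, (U φ).fst = 1 / √(N : ℝ) * ∑ x, φ x

/-- Such an orthogonal map exists as soon as the lattice is non-empty. -/
theorem exists_isMagnetizationFrame {N : ℕ} (hN : 1 ≤ N) :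
    ∃ U : Config N ≃ₗᵢ[ℝ] Split N, IsMagnetizationFrame U := by
  classical
  have hN0 : (0 : ℝ) < N := by exact_mod_cast hN
  let v : Config N := WithLp.toLp 2 (fun _ => 1 / √(N : ℝ))
  have hv : ‖v‖ = 1 := by
    rw [EuclideanSpace.norm_eq, Real.sqrt_eq_one]
    simp [v, Real.sq_sqrt hN0.le, hN0.ne']
  let w : Unit ⊕ Fin (N - 1) → Config N := fun _ => v
  have hw : Orthonormal ℝ (({Sum.inl ()} : Set (Unit ⊕ Fin (N - 1))).domRestrict w) := by
    rw [orthonormal_iff_ite]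
    rintro ⟨i, hi⟩ ⟨j, hj⟩
    obtain rfl : i = Sum.inl () := hi
    obtain rfl : j = Sum.inl () := hj
    simp [w, Set.domRestrict, hv]
  have hc : Module.finrank ℝ (Config N) = Fintype.card (Unit ⊕ Fin (N - 1)) := by
    simp; omega
  obtain ⟨b, hb⟩ := hw.exists_orthonormalBasis_extension_of_card_eq hc
  let b' : OrthonormalBasis (Unit ⊕ Fin (N - 1)) ℝ (Split N) :=
    (OrthonormalBasis.singleton Unit ℝ).prod (EuclideanSpace.basisFun (Fin (N - 1)) ℝ)
  refine ⟨b.equiv b' (Equiv.refl _), fun φ => ?_⟩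
  have h1 : b (Sum.inl ()) = v := hb _ rfl
  have h2 : b.equiv b' (Equiv.refl _) v = b' (Sum.inl ()) := by
    rw [← h1, OrthonormalBasis.equiv_apply_basis]; rfl
  have h3 := (b.equiv b' (Equiv.refl _)).inner_map_map v φ
  rw [h2] at h3
  simp [b', v, WithLp.prod_inner_apply, PiLp.inner_apply] at h3
  rw [h3, Finset.mul_sum]
  exact Finset.sum_congr rfl fun x _ => by ring

/-- The auxiliary microcanonical ensemble with magnetization density `m` and particle density `ρ`:
the law of `U⁻¹ (m √N, √(N (ρ - m²)) Ω)` for `Ω` uniformly distributed (with respect to the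
normalized surface measure) on the unit sphere `𝕊^{N-2}` of `ℝ^{N-1}`. -/
def microcanonical {N : ℕ} (U : Config N ≃ₗᵢ[ℝ] Split N) (m ρ : ℝ) : Measure (Config N) :=
  let σ : Measure (Metric.sphere (0 : EuclideanSpace ℝ (Fin (N - 1))) 1) :=
    (volume : Measure (EuclideanSpace ℝ (Fin (N - 1)))).toSphere
  ((σ Set.univ)⁻¹ • σ).map fun (Ω : Metric.sphere (0 : EuclideanSpace ℝ (Fin (N - 1))) 1) =>
    U.symm (WithLp.toLp 2
      (m * √(N : ℝ), √((N : ℝ) * (ρ - m ^ 2)) • (Ω : EuclideanSpace ℝ (Fin (N - 1)))))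

/-- The auxiliary grand canonical ensemble with magnetic potential `μ` and chemical potential `η`:
Lebesgue measure with density `exp (-μ M[φ] - η N[φ])`, normalized by the integral of this
function. -/
def grandCanonical (N : ℕ) (μ η : ℝ) : Measure (Config N) :=
  (volume : Measure (Config N)).tilted fun φ => -μ * magnetization φ - η * particleNumber φ

/-- The projection `P_I : ℝ^N → ℝ^n`, `n = |I|`, onto the coordinates in `I ⊆ [N]`, listed in
increasing order. -/
def proj {N n : ℕ} (I : Finset (Fin N)) (hI : I.card = n) (φ : Config N) :
    EuclideanSpace ℝ (Fin n) :=
  WithLp.toLp 2 fun j => φ (I.orderEmbOfFin hI j)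

/-- Bounded observables that are `1`-Lipschitz for the Euclidean norm. -/
def IsBoundedLipschitz {n : ℕ} (f : EuclideanSpace ℝ (Fin n) → ℝ) : Prop :=
  (∃ B : ℝ, ∀ y, |f y| ≤ B) ∧ LipschitzWith 1 f

/-- Moment observables: finite products `y₁^{k₁} ⋯ yₙ^{kₙ}` of finite powers of the coordinates. -/
def IsMoment {n : ℕ} (f : EuclideanSpace ℝ (Fin n) → ℝ) : Prop :=
  ∃ k : Fin n → ℕ, ∀ y, f y = ∏ i, y i ^ k i

end SphericalModel

end

/-!
Both ensembles are realised on one probability space, carrying a standard Gaussian `ξ` on `ℝ^N`.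
With `v = ρ - m²`, completing the square identifies the grand canonical ensemble with the law of
`m + √v ξ`. Write `U ξ = (z, g)`. The direction `g / ‖g‖` is uniform on the sphere `𝕊^{N-2}`, so
`U⁻¹ (m √N, √(N v) g / ‖g‖)` has the microcanonical law. At the site `x` the two fields differ by
`√v ((√N - ‖g‖) ⟪w, g / ‖g‖⟫ - z / √N)`, where `w` is the part of the unit vector at `x` orthogonal
to the constants. The norm and the direction of `g` are independent; `‖g‖` stays within `O(1)` of
`√N` in mean square, and `⟪w, g / ‖g‖⟫` is `O(N^{-1/2})` in every `Lᵖ`, since its product with the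
independent factor `‖g‖` is the Gaussian variable `⟪w, g⟫`. The fields are therefore
`O(N^{-1/2})`-close in mean square at each site. Moments are only locally Lipschitz, but their
Lipschitz constant grows polynomially, so the Cauchy–Schwarz inequality and the volume-independent
bounds on the moments of the fields conclude.
-/

namespace SphericalModel

open ProbabilityTheory

section ChangeOfMeasure

variable {α β : Type*} {mα : MeasurableSpace α} {mβ : MeasurableSpace β} {ν : Measure α}

theorem map_withDensity_comp {G : α → β} (hG : Measurable G) {k : β → ENNReal}
    (hk : Measurable k) : (ν.withDensity (k ∘ G)).map G = (ν.map G).withDensity k := by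
  ext s hs
  rw [Measure.map_apply hG hs, withDensity_apply _ (hG hs), withDensity_apply _ hs,
    setLIntegral_map hs hk hG]
  rfl

theorem map_tilted_comp {G : α → β} (hG : Measurable G) {g : β → ℝ} (hg : Measurable g) :
    (ν.tilted (g ∘ G)).map G = (ν.map G).tilted g := by
  have hZ : ∫ y, Real.exp (g y) ∂ν.map G = ∫ x, Real.exp (g (G x)) ∂ν :=
    integral_map hG.aemeasurable (by fun_prop)
  rw [Measure.tilted, Measure.tilted, hZ, ← map_withDensity_comp hG (by fun_prop)]
  rfl

theorem tilted_smul_measure {c : ENNReal} (hc₀ : c ≠ 0) (hc : c ≠ ⊤) (g : α → ℝ) :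
    (c • ν).tilted g = ν.tilted g := by
  rw [Measure.tilted, integral_smul_measure, withDensity_smul_measure,
    ← withDensity_smul' _ _ hc, Measure.tilted]
  congr 1 with x
  rw [Pi.smul_apply, smul_eq_mul, smul_eq_mul, div_mul_eq_div_div_swap,
    ENNReal.ofReal_div_of_pos (ENNReal.toReal_pos hc₀ hc), ENNReal.ofReal_toReal hc,
    ENNReal.mul_div_cancel hc₀ hc]

theorem tilted_add_const (f : α → ℝ) (c : ℝ) :
    ν.tilted (fun x => f x + c) = ν.tilted f := by
  simp only [Measure.tilted, Real.exp_add, integral_mul_const]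
  congr 2 with x
  rw [mul_div_mul_right _ _ (Real.exp_pos c).ne']

section ProductLaw

variable {Ω : Type*} {mΩ : MeasurableSpace Ω} {P : Measure Ω} [IsProbabilityMeasure P]
  {X : Ω → α} {Y : Ω → β} {σ : Measure α} {τ : Measure β} [SFinite τ]

theorem measure_univ_mul_measure_univ_of_map_eq_prod (hX : Measurable X) (hY : Measurable Y)
    (h : P.map (fun ω => (X ω, Y ω)) = σ.prod τ) : σ Set.univ * τ Set.univ = 1 := by
  rw [← Measure.prod_prod, ← h, Set.univ_prod_univ, Measure.map_apply (by fun_prop) .univ,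
    Set.preimage_univ, measure_univ]

theorem map_eq_smul_of_map_prodMk_eq_prod (hX : Measurable X) (hY : Measurable Y)
    (h : P.map (fun ω => (X ω, Y ω)) = σ.prod τ) : P.map X = (σ Set.univ)⁻¹ • σ := by
  have hmass := measure_univ_mul_measure_univ_of_map_eq_prod hX hY h
  rw [← ENNReal.eq_inv_of_mul_eq_one_left ((mul_comm _ _).trans hmass), ← Measure.map_fst_prod,
    ← h, Measure.map_map (by fun_prop) (by fun_prop)]
  rfl

theorem indepFun_of_map_prodMk_eq_prod (hX : Measurable X) (hY : Measurable Y)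
    (h : P.map (fun ω => (X ω, Y ω)) = σ.prod τ) : IndepFun X Y P := by
  have hmass := measure_univ_mul_measure_univ_of_map_eq_prod hX hY h
  have hY_law : P.map Y = σ Set.univ • τ := by
    rw [← Measure.map_snd_prod, ← h, Measure.map_map (by fun_prop) (by fun_prop)]
    rfl
  rw [indepFun_iff_map_prod_eq_prod_map_map hX.aemeasurable hY.aemeasurable, h, hY_law,
    map_eq_smul_of_map_prodMk_eq_prod hX hY h, Measure.prod_smul_left, Measure.prod_smul_right,
    smul_smul, ENNReal.inv_mul_cancel (left_ne_zero_of_mul_eq_one hmass), one_smul]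
  exact fun hσ => by simp [hσ, ENNReal.top_mul (right_ne_zero_of_mul_eq_one hmass)] at hmass

end ProductLaw

end ChangeOfMeasure

section LpNorm

variable {Ω : Type*} {mΩ : MeasurableSpace Ω} {P : Measure Ω}

theorem eLpNorm_two_eq_ofReal_sqrt {f : Ω → ℝ} (hf : MemLp f 2 P) :
    eLpNorm f 2 P = ENNReal.ofReal √(∫ ω, f ω ^ 2 ∂P) := by
  rw [hf.eLpNorm_eq_integral_rpow_norm two_ne_zero ENNReal.ofNat_ne_top, Real.sqrt_eq_rpow]
  simp

theorem eLpNorm_mul_of_indepFun {X Y : Ω → ℝ} (hX : Measurable X) (hY : Measurable Y)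
    (h : IndepFun X Y P) {p : ENNReal} (hp₀ : p ≠ 0) (hp : p ≠ ⊤) :
    eLpNorm (fun ω => X ω * Y ω) p P = eLpNorm X p P * eLpNorm Y p P := by
  have hpow : Measurable fun t : ℝ => ‖t‖ₑ ^ p.toReal := by fun_prop
  have hprod := lintegral_mul_eq_lintegral_mul_lintegral_of_indepFun (hpow.comp hX)
    (hpow.comp hY) (h.comp hpow hpow)
  simp only [eLpNorm_eq_lintegral_rpow_enorm_toReal hp₀ hp, enorm_mul]
  rw [← ENNReal.mul_rpow_of_nonneg _ _ (by positivity)]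
  refine congrArg (· ^ _) (Eq.trans (lintegral_congr fun ω => ?_) hprod)
  exact ENNReal.mul_rpow_of_nonneg _ _ ENNReal.toReal_nonneg

theorem eLpNorm_const_add_const_mul_le [IsProbabilityMeasure P] (a : ℝ) {c : ℝ} (hc : 0 ≤ c)
    {X : Ω → ℝ} (hX : AEStronglyMeasurable X P) {p : ENNReal} (hp : 1 ≤ p) :
    eLpNorm (fun ω => a + c * X ω) p P ≤
      ENNReal.ofReal |a| + ENNReal.ofReal c * eLpNorm X p P := by
  refine (eLpNorm_add_le (f := fun _ => a) (by fun_prop) (by fun_prop) hp).trans_eq ?_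
  rw [eLpNorm_const _ (zero_lt_one.trans_le hp).ne' (NeZero.ne P), measure_univ, ENNReal.one_rpow,
    mul_one, Real.enorm_eq_ofReal_abs]
  exact congrArg _ <| (eLpNorm_const_smul c X p P).trans (by rw [Real.enorm_of_nonneg hc])

theorem eLpNorm_euclideanSpace_le_sum {ι : Type*} [Fintype ι] {V : Ω → EuclideanSpace ℝ ι}
    (hV : AEStronglyMeasurable V P) {p : ENNReal} (hp : 1 ≤ p) :
    eLpNorm V p P ≤ ∑ i, eLpNorm (fun ω => V ω i) p P := by
  classical
  have hV_i (i : ι) : AEStronglyMeasurable (fun ω => V ω i) P :=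
    (EuclideanSpace.proj i).continuous.comp_aestronglyMeasurable hV
  have hsum : V = ∑ i, fun ω => V ω i • EuclideanSpace.single i (1 : ℝ) := by
    ext ω j
    simp [Finset.sum_apply, Pi.single_apply]
  calc eLpNorm V p P
      = eLpNorm (∑ i, fun ω => V ω i • EuclideanSpace.single i (1 : ℝ)) p P := by rw [← hsum]
    _ ≤ ∑ i, eLpNorm (fun ω => V ω i • EuclideanSpace.single i (1 : ℝ)) p P :=
        eLpNorm_sum_le (fun i _ => (hV_i i).smul_const _) hp
    _ = ∑ i, eLpNorm (fun ω => V ω i) p P :=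
        Finset.sum_congr rfl fun i _ => eLpNorm_congr_norm_ae (.of_forall fun ω => by
          simp [norm_smul])

end LpNorm

section StdGaussian

variable {E : Type*} [NormedAddCommGroup E] [InnerProductSpace ℝ E] [FiniteDimensional ℝ E]
  [MeasurableSpace E] [BorelSpace E]

theorem stdGaussian_eq_tilted :
    stdGaussian E = (volume : Measure E).tilted (fun x => -(1 / 2) * ‖x‖ ^ 2) := by
  have hhalf : 0 < ((1 / 2 : ℝ) : ℂ).re := by norm_num
  have hmass : 0 < ∫ x : E, Real.exp (-(1 / 2) * ‖x‖ ^ 2) := by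
    rw [GaussianFourier.integral_rexp_neg_mul_sq_norm (by norm_num)]
    positivity
  have hmass_cexp : ∫ x : E, Complex.exp (-((1 / 2 : ℝ) : ℂ) * ‖x‖ ^ 2) =
      (∫ x : E, Real.exp (-(1 / 2) * ‖x‖ ^ 2) : ℝ) := by
    rw [← integral_complex_ofReal]
    push_cast
    rfl
  have := isProbabilityMeasure_tilted (.of_integral_ne_zero hmass.ne')
  refine Measure.ext_of_charFun (funext fun t => ?_)
  rw [charFun_stdGaussian, charFun_apply, integral_tilted]
  set Z := ∫ x : E, Real.exp (-(1 / 2) * ‖x‖ ^ 2)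
  have hintegrand (x : E) : (Real.exp (-(1 / 2) * ‖x‖ ^ 2) / Z) •
      Complex.exp (inner ℝ x t * Complex.I) =
        (Z : ℂ)⁻¹ * Complex.exp (-((1 / 2 : ℝ) : ℂ) * ‖x‖ ^ 2 + Complex.I * inner ℝ t x) := by
    rw [Complex.real_smul, Complex.exp_add, real_inner_comm t x]
    push_cast
    ring_nf
  simp_rw [hintegrand]
  rw [integral_const_mul, GaussianFourier.integral_cexp_neg_mul_sq_norm_add hhalf,
    ← GaussianFourier.integral_cexp_neg_mul_sq_norm hhalf, hmass_cexp,
    inv_mul_cancel_left₀ (Complex.ofReal_ne_zero.2 hmass.ne'), Complex.I_sq]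
  push_cast
  ring_nf

theorem map_inner_stdGaussian (w : E) :
    (stdGaussian E).map (fun x => inner ℝ w x) = (gaussianReal 0 1).map (‖w‖ * ·) := by
  have h := IsGaussian.map_eq_gaussianReal (μ := stdGaussian E) (innerSL ℝ w)
  rw [integral_strongDual_stdGaussian, variance_dual_stdGaussian, innerSL_apply_norm] at h
  rw [gaussianReal_map_const_mul, mul_zero, mul_one]
  exact h.trans (congrArg _ (Real.toNNReal_of_nonneg (sq_nonneg _)))

/-- The `Lᵖ` norm of a standard normal random variable. -/
noncomputable def gaussianLpNorm (p : ENNReal) : ENNReal := eLpNorm id p (gaussianReal 0 1)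

theorem gaussianLpNorm_ne_top {p : ENNReal} (hp : p ≠ ⊤) : gaussianLpNorm p ≠ ⊤ :=
  (memLp_id_gaussianReal' p hp).eLpNorm_ne_top

theorem eLpNorm_inner_stdGaussian (w : E) (p : ENNReal) :
    eLpNorm (fun x => inner ℝ w x) p (stdGaussian E) = ‖w‖ₑ * gaussianLpNorm p :=
  calc eLpNorm (fun x => inner ℝ w x) p (stdGaussian E)
      = eLpNorm id p ((stdGaussian E).map fun x => inner ℝ w x) :=
        (eLpNorm_map_measure aestronglyMeasurable_id (by fun_prop)).symm
    _ = eLpNorm (‖w‖ • id) p (gaussianReal 0 1) := by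
        rw [map_inner_stdGaussian]
        exact eLpNorm_map_measure aestronglyMeasurable_id (by fun_prop)
    _ = ‖w‖ₑ * gaussianLpNorm p := by rw [eLpNorm_const_smul, enorm_norm, gaussianLpNorm]

theorem integral_sq_gaussianReal : ∫ x, x ^ 2 ∂gaussianReal 0 1 = 1 := by
  have h := variance_fun_id_gaussianReal (μ := 0) (v := 1)
  rwa [variance_of_integral_eq_zero (by fun_prop) (by simp)] at h

theorem memLp_sq_gaussianReal : MemLp (fun x : ℝ => x ^ 2) 2 (gaussianReal 0 1) := by
  have h := (memLp_id_gaussianReal' (μ := 0) (v := 1) 4 (by simp)).integrable_norm_pow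
    four_ne_zero
  rw [memLp_two_iff_integrable_sq (by fun_prop)]
  simpa [← pow_mul, Even.pow_abs (n := 4) (by decide)] using h

theorem identDistrib_norm_sq_stdGaussian :
    IdentDistrib (fun x : E => ‖x‖ ^ 2)
      (∑ i, fun x : Fin (Module.finrank ℝ E) → ℝ => x i ^ 2)
      (stdGaussian E) (Measure.pi fun _ => gaussianReal 0 1) where
  aemeasurable_fst := by fun_prop
  aemeasurable_snd := by fun_prop
  map_eq := by
    let b := stdOrthonormalBasis ℝ E
    rw [stdGaussian_eq_map_pi_orthonormalBasis b, Measure.map_map (by fun_prop) (by fun_prop)]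
    congr 1 with x
    simp [← b.sum_sq_norm_inner_right, b.orthonormal.inner_right_fintype]

theorem memLp_norm_sq_stdGaussian : MemLp (fun x : E => ‖x‖ ^ 2) 2 (stdGaussian E) :=
  identDistrib_norm_sq_stdGaussian.memLp_iff.2 <| memLp_finsetSum' _ fun i _ =>
    memLp_sq_gaussianReal.comp_measurePreserving (measurePreserving_eval _ i)

theorem integral_norm_sq_stdGaussian :
    ∫ x, ‖x‖ ^ 2 ∂stdGaussian E = Module.finrank ℝ E := by
  have hsq := memLp_sq_gaussianReal.integrable one_le_two
  have hcoord_int (i : Fin (Module.finrank ℝ E)) :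
      Integrable (fun x : Fin (Module.finrank ℝ E) → ℝ => x i ^ 2)
        (Measure.pi fun _ => gaussianReal 0 1) :=
    integrable_comp_eval (μ := fun _ => gaussianReal 0 1) hsq
  have hcoord (i : Fin (Module.finrank ℝ E)) :
      ∫ x, x i ^ 2 ∂Measure.pi (fun _ => gaussianReal 0 1) = 1 :=
    (integral_comp_eval (μ := fun _ => gaussianReal 0 1) hsq.1).trans integral_sq_gaussianReal
  simp only [identDistrib_norm_sq_stdGaussian.integral_eq, Finset.sum_apply]
  rw [integral_finsetSum _ fun i _ => hcoord_int i]
  simp [hcoord]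

theorem variance_norm_sq_stdGaussian :
    Var[fun x => ‖x‖ ^ 2; stdGaussian E] =
      Module.finrank ℝ E * Var[fun x => x ^ 2; gaussianReal 0 1] := by
  rw [identDistrib_norm_sq_stdGaussian.variance_eq,
    variance_sum_pi (X := fun _ (x : ℝ) => x ^ 2) fun _ => memLp_sq_gaussianReal]
  simp

theorem eLpNorm_norm_stdGaussian :
    eLpNorm (fun x : E => ‖x‖) 2 (stdGaussian E) = ENNReal.ofReal √(Module.finrank ℝ E) := by
  have hnorm : MemLp (fun x : E => ‖x‖) 2 (stdGaussian E) :=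
    (memLp_two_iff_integrable_sq (by fun_prop)).2 (memLp_norm_sq_stdGaussian.integrable one_le_two)
  rw [eLpNorm_two_eq_ofReal_sqrt hnorm, integral_norm_sq_stdGaussian]

/-- The standard deviation of the square of a standard normal random variable; all that matters
is that it does not depend on the dimension. -/
noncomputable def gaussianSqStdDev : ℝ := √Var[fun x => x ^ 2; gaussianReal 0 1]

theorem gaussianSqStdDev_nonneg : 0 ≤ gaussianSqStdDev := Real.sqrt_nonneg _

theorem eLpNorm_norm_sq_sub_finrank_stdGaussian :
    eLpNorm (fun x : E => ‖x‖ ^ 2 - Module.finrank ℝ E) 2 (stdGaussian E) =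
      ENNReal.ofReal (√(Module.finrank ℝ E) * gaussianSqStdDev) := by
  have hcentered : MemLp (fun x : E => ‖x‖ ^ 2 - Module.finrank ℝ E) 2 (stdGaussian E) :=
    memLp_norm_sq_stdGaussian.sub (memLp_const _)
  rw [eLpNorm_two_eq_ofReal_sqrt hcentered, gaussianSqStdDev,
    ← Real.sqrt_mul (Nat.cast_nonneg _), ← variance_norm_sq_stdGaussian,
    variance_eq_integral (by fun_prop), integral_norm_sq_stdGaussian]

theorem eLpNorm_norm_sub_sqrt_finrank_stdGaussian_le [Nontrivial E] :
    eLpNorm (fun x : E => ‖x‖ - √(Module.finrank ℝ E)) 2 (stdGaussian E) ≤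
      ENNReal.ofReal gaussianSqStdDev := by
  have hd_pos : (0 : ℝ) < Module.finrank ℝ E := Nat.cast_pos.2 Module.finrank_pos
  set d : ℝ := (Module.finrank ℝ E : ℝ) with hd
  have hpointwise (x : E) : ‖‖x‖ - √d‖ ≤ (√d)⁻¹ * ‖‖x‖ ^ 2 - d‖ := by
    have hfactor : ‖x‖ ^ 2 - d = (‖x‖ + √d) * (‖x‖ - √d) := by
      rw [← sq_sub_sq, Real.sq_sqrt hd_pos.le]
    rw [hfactor, norm_mul, le_inv_mul_iff₀ (by positivity),
      Real.norm_of_nonneg (show 0 ≤ ‖x‖ + √d by positivity)]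
    gcongr
    exact le_add_of_nonneg_left (norm_nonneg x)
  calc eLpNorm (fun x : E => ‖x‖ - √d) 2 (stdGaussian E)
      ≤ ENNReal.ofReal (√d)⁻¹ * eLpNorm (fun x : E => ‖x‖ ^ 2 - d) 2 (stdGaussian E) :=
        eLpNorm_le_mul_eLpNorm_of_ae_le_mul (.of_forall hpointwise) 2
    _ = ENNReal.ofReal gaussianSqStdDev := by
        rw [hd, eLpNorm_norm_sq_sub_finrank_stdGaussian, ← hd,
          ← ENNReal.ofReal_mul (by positivity), inv_mul_cancel_left₀ (by positivity)]

theorem map_stdGaussian_of_norm_adjoint_apply {F : Type*} [NormedAddCommGroup F]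
    [InnerProductSpace ℝ F] [FiniteDimensional ℝ F] [MeasurableSpace F] [BorelSpace F]
    (L : E →L[ℝ] F) (hL : ∀ y, ‖L.adjoint y‖ = ‖y‖) : (stdGaussian E).map L = stdGaussian F := by
  have := Measure.isProbabilityMeasure_map (μ := stdGaussian E) L.continuous.aemeasurable
  refine Measure.ext_of_charFun (funext fun y => ?_)
  rw [charFun_apply, integral_map L.continuous.aemeasurable (by fun_prop)]
  simp only [← L.adjoint_inner_right]
  rw [← charFun_apply, charFun_stdGaussian, charFun_stdGaussian, hL]

end StdGaussian

section Polar

variable {E : Type*} [NormedAddCommGroup E] [InnerProductSpace ℝ E] [FiniteDimensional ℝ E]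
  [MeasurableSpace E] [BorelSpace E]

theorem measurable_normalize : Measurable (NormedSpace.normalize : E → E) := by
  unfold NormedSpace.normalize
  fun_prop

theorem map_normalize_norm_addHaar [Nontrivial E] (μ : Measure E) [μ.IsAddHaarMeasure] :
    μ.map (fun x => (NormedSpace.normalize x, ‖x‖)) =
      (μ.toSphere.map (↑)).prod ((Measure.volumeIoiPow (Module.finrank ℝ E - 1)).map (↑)) := by
  have hpolar : (fun x : E => (NormedSpace.normalize x, ‖x‖)) ∘ ((↑) : ({0}ᶜ : Set E) → E) =
      Prod.map (↑) (↑) ∘ homeomorphUnitSphereProd E := by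
    ext x <;> simp [NormedSpace.normalize]
  calc μ.map (fun x => (NormedSpace.normalize x, ‖x‖))
      = (μ.restrict {0}ᶜ).map (fun x => (NormedSpace.normalize x, ‖x‖)) := by
        rw [restrict_compl_singleton]
    _ = (μ.comap (↑)).map (Prod.map (↑) (↑) ∘ homeomorphUnitSphereProd E) := by
        rw [← map_comap_subtype_coe (measurableSet_singleton _).compl, ← hpolar,
          Measure.map_map (measurable_normalize.prodMk measurable_norm) measurable_subtype_coe]
    _ = _ := by
        rw [← Measure.map_map (by fun_prop) (homeomorphUnitSphereProd E).measurable,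
          μ.measurePreserving_homeomorphUnitSphereProd.map_eq,
          Measure.map_prod_map _ _ (by fun_prop) (by fun_prop)]

theorem map_normalize_norm_stdGaussian [Nontrivial E] :
    (stdGaussian E).map (fun x => (NormedSpace.normalize x, ‖x‖)) =
      ((volume : Measure E).toSphere.map (↑)).prod
        (((Measure.volumeIoiPow (Module.finrank ℝ E - 1)).map (↑)).withDensity fun r =>
          ENNReal.ofReal (Real.exp (-(1 / 2) * r ^ 2) /
            ∫ x : E, Real.exp (-(1 / 2) * ‖x‖ ^ 2))) := by
  rw [prod_withDensity_right (by fun_prop), ← map_normalize_norm_addHaar,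
    ← map_withDensity_comp (measurable_normalize.prodMk measurable_norm) (by fun_prop),
    stdGaussian_eq_tilted]
  rfl

theorem indepFun_norm_normalize_stdGaussian [Nontrivial E] :
    IndepFun (fun x : E => ‖x‖) NormedSpace.normalize (stdGaussian E) :=
  (indepFun_of_map_prodMk_eq_prod measurable_normalize measurable_norm
    map_normalize_norm_stdGaussian).symm

theorem map_normalize_stdGaussian [Nontrivial E] :
    (stdGaussian E).map NormedSpace.normalize =
      ((volume : Measure E).toSphere Set.univ)⁻¹ • (volume : Measure E).toSphere.map (↑) := by
  rw [map_eq_smul_of_map_prodMk_eq_prod measurable_normalize measurable_norm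
    map_normalize_norm_stdGaussian, Measure.map_apply measurable_subtype_coe .univ,
    Set.preimage_univ]

theorem sqrt_finrank_mul_eLpNorm_inner_normalize_le [Nontrivial E] (w : E)
    {p : ENNReal} (hp : 2 ≤ p) (hp_top : p ≠ ⊤) :
    ENNReal.ofReal √(Module.finrank ℝ E) *
      eLpNorm (fun x => inner ℝ w (NormedSpace.normalize x)) p (stdGaussian E) ≤
        ‖w‖ₑ * gaussianLpNorm p := by
  have hmeas : Measurable fun x : E => inner ℝ w (NormedSpace.normalize x) :=
    measurable_const.inner measurable_normalize
  calc ENNReal.ofReal √(Module.finrank ℝ E) *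
        eLpNorm (fun x => inner ℝ w (NormedSpace.normalize x)) p (stdGaussian E)
      ≤ eLpNorm (fun x : E => ‖x‖) p (stdGaussian E) *
          eLpNorm (fun x => inner ℝ w (NormedSpace.normalize x)) p (stdGaussian E) := by
        rw [← eLpNorm_norm_stdGaussian]
        gcongr
        exact eLpNorm_le_eLpNorm_of_exponent_le hp (by fun_prop)
    _ = eLpNorm (fun x => ‖x‖ * inner ℝ w (NormedSpace.normalize x)) p (stdGaussian E) :=
        (eLpNorm_mul_of_indepFun measurable_norm hmeas
          (indepFun_norm_normalize_stdGaussian.comp measurable_id (by fun_prop))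
          (two_pos.trans_le hp).ne' hp_top).symm
    _ = eLpNorm (fun x => inner ℝ w x) p (stdGaussian E) := by
        simp only [← real_inner_smul_right, NormedSpace.norm_smul_normalize]
    _ = ‖w‖ₑ * gaussianLpNorm p := eLpNorm_inner_stdGaussian w p

end Polar

section Fields

variable {N : ℕ}

/-- The grand canonical field `m + √v ξ` driven by a configuration `ξ`, to be sampled from the
standard Gaussian measure. -/
noncomputable def gaussianField (m v : ℝ) (ξ : Config N) : Config N :=
  WithLp.toLp 2 (fun _ => m) + √v • ξ

/-- The microcanonical field driven by a configuration `ξ`, to be sampled from the standard Gaussian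
measure: the direction on the sphere is that of the part of `ξ` orthogonal to the constants. -/
noncomputable def sphericalField (U : Config N ≃ₗᵢ[ℝ] Split N) (m v : ℝ) (ξ : Config N) :
    Config N :=
  U.symm (WithLp.toLp 2
    (m * √(N : ℝ), √((N : ℝ) * v) • NormedSpace.normalize (U ξ).snd))

/-- The part of the unit vector at the site `x` orthogonal to the constants. -/
noncomputable def siteDirection (U : Config N ≃ₗᵢ[ℝ] Split N) (x : Fin N) :
    EuclideanSpace ℝ (Fin (N - 1)) :=
  (U (EuclideanSpace.single x 1)).snd

theorem measurable_gaussianField (m v : ℝ) :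
    Measurable (gaussianField m v : Config N → Config N) := by
  unfold gaussianField
  fun_prop

theorem measurable_sphericalField (U : Config N ≃ₗᵢ[ℝ] Split N) (m v : ℝ) :
    Measurable (sphericalField U m v) := by
  unfold sphericalField NormedSpace.normalize
  fun_prop

theorem map_gaussianField_stdGaussian (m : ℝ) {v : ℝ} (hv : 0 < v) :
    (stdGaussian (Config N)).map (gaussianField m v) =
      grandCanonical N (-(m / v)) (1 / (2 * v)) := by
  set a : Config N := WithLp.toLp 2 fun _ => m
  set V : Config N → ℝ := fun φ => -(1 / (2 * v)) * ‖φ - a‖ ^ 2 with hV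
  have hpullback : (fun ξ : Config N => -(1 / 2) * ‖ξ‖ ^ 2) = V ∘ gaussianField m v := by
    ext ξ
    simp only [hV, Function.comp_apply, gaussianField, add_sub_cancel_left, norm_smul, mul_pow,
      Real.norm_eq_abs, sq_abs, Real.sq_sqrt hv.le, a]
    field_simp
  have hvolume : (volume : Measure (Config N)).map (gaussianField m v) =
      ENNReal.ofReal |(√v ^ Module.finrank ℝ (Config N))⁻¹| • volume := by
    rw [show gaussianField m v = (a + ·) ∘ (√v • · : Config N → Config N) from rfl,
      ← Measure.map_map (by fun_prop) (by fun_prop),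
      Measure.map_addHaar_smul _ (Real.sqrt_pos.2 hv).ne', Measure.map_smul, map_add_left_eq_self]
  have hscale : 0 < |(√v ^ Module.finrank ℝ (Config N))⁻¹| := by positivity
  rw [stdGaussian_eq_tilted, hpullback,
    map_tilted_comp (measurable_gaussianField m v) (by fun_prop), hvolume,
    tilted_smul_measure (ENNReal.ofReal_pos.2 hscale).ne' ENNReal.ofReal_ne_top,
    grandCanonical, ← tilted_add_const _ (1 / (2 * v) * (N * m ^ 2))]
  congr 1 with φ
  simp only [hV, a, magnetization, particleNumber, EuclideanSpace.real_norm_sq_eq,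
    PiLp.sub_apply, sub_sq, Finset.sum_add_distrib, Finset.sum_sub_distrib, Finset.sum_const,
    Finset.card_univ, Fintype.card_fin, nsmul_eq_mul, ← Finset.sum_mul, ← Finset.mul_sum]
  field_simp
  ring

theorem measurePreserving_snd_stdGaussian (U : Config N ≃ₗᵢ[ℝ] Split N) :
    MeasurePreserving (fun ξ => (U ξ).snd) (stdGaussian (Config N))
      (stdGaussian (EuclideanSpace ℝ (Fin (N - 1)))) where
  measurable := by fun_prop
  map_eq := by
    let L : Config N →L[ℝ] EuclideanSpace ℝ (Fin (N - 1)) :=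
      WithLp.sndL 2 ℝ ℝ _ ∘L U.toContinuousLinearEquiv.toContinuousLinearMap
    have hadjoint (y : EuclideanSpace ℝ (Fin (N - 1))) :
        L.adjoint y = U.symm (WithLp.toLp 2 (0, y)) := by
      refine ext_inner_right ℝ fun ξ => ?_
      rw [L.adjoint_inner_left, ← U.inner_map_map, U.apply_symm_apply, WithLp.prod_inner_apply]
      simp [L]
    exact map_stdGaussian_of_norm_adjoint_apply L fun y => by simp [hadjoint]

theorem eLpNorm_fst_stdGaussian (U : Config N ≃ₗᵢ[ℝ] Split N) (p : ENNReal) :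
    eLpNorm (fun ξ => (U ξ).fst) p (stdGaussian (Config N)) = gaussianLpNorm p := by
  have hfst (ξ : Config N) : (U ξ).fst = inner ℝ (U.symm (WithLp.toLp 2 (1, 0))) ξ := by
    rw [← U.inner_map_map, U.apply_symm_apply, WithLp.prod_inner_apply]
    simp
  simp only [hfst]
  rw [eLpNorm_inner_stdGaussian, ← ofReal_norm]
  simp

theorem map_sphericalField_stdGaussian (hN : 2 ≤ N) (U : Config N ≃ₗᵢ[ℝ] Split N) (m ρ : ℝ) :
    (stdGaussian (Config N)).map (sphericalField U m (ρ - m ^ 2)) = microcanonical U m ρ := by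
  have : Nonempty (Fin (N - 1)) := ⟨⟨0, by omega⟩⟩
  set embed : EuclideanSpace ℝ (Fin (N - 1)) → Config N := fun y =>
    U.symm (WithLp.toLp 2 (m * √(N : ℝ), √((N : ℝ) * (ρ - m ^ 2)) • y))
  have hembed : Measurable embed := by fun_prop
  calc (stdGaussian (Config N)).map (sphericalField U m (ρ - m ^ 2))
      = (((stdGaussian (Config N)).map fun ξ => (U ξ).snd).map
          NormedSpace.normalize).map embed := by
        rw [Measure.map_map hembed measurable_normalize, Measure.map_map
          (hembed.comp measurable_normalize) (measurePreserving_snd_stdGaussian U).measurable]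
        rfl
    _ = microcanonical U m ρ := by
        rw [(measurePreserving_snd_stdGaussian U).map_eq, map_normalize_stdGaussian,
          ← Measure.map_smul, Measure.map_map hembed measurable_subtype_coe]
        rfl

theorem norm_siteDirection_le (U : Config N ≃ₗᵢ[ℝ] Split N) (x : Fin N) :
    ‖siteDirection U x‖ ≤ 1 :=
  calc ‖siteDirection U x‖ ≤ ‖U (EuclideanSpace.single x 1)‖ := WithLp.norm_snd_le ..
    _ = 1 := by simp

theorem IsMagnetizationFrame.symm_apply {U : Config N ≃ₗᵢ[ℝ] Split N}
    (hU : IsMagnetizationFrame U) (ψ : Split N) (x : Fin N) :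
    U.symm ψ x = 1 / √(N : ℝ) * ψ.fst + inner ℝ (siteDirection U x) ψ.snd := by
  have hfst : (U (EuclideanSpace.single x 1)).fst = 1 / √(N : ℝ) := by
    rw [hU]
    simp
  calc U.symm ψ x = inner ℝ (EuclideanSpace.single x (1 : ℝ)) (U.symm ψ) := by
        simp [EuclideanSpace.inner_single_left]
    _ = 1 / √(N : ℝ) * ψ.fst + inner ℝ (siteDirection U x) ψ.snd := by
        rw [← U.inner_map_map, U.apply_symm_apply, WithLp.prod_inner_apply, ← hfst, mul_comm]
        rfl

theorem gaussianField_apply (m v : ℝ) (ξ : Config N) (x : Fin N) :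
    gaussianField m v ξ x = m + √v * ξ x := rfl

variable {U : Config N ≃ₗᵢ[ℝ] Split N}

theorem IsMagnetizationFrame.sphericalField_apply (hU : IsMagnetizationFrame U) (m v : ℝ)
    (ξ : Config N) (x : Fin N) :
    sphericalField U m v ξ x =
      m + √v * (√(N : ℝ) * inner ℝ (siteDirection U x) (NormedSpace.normalize (U ξ).snd)) := by
  have hN : √(N : ℝ) ≠ 0 := (Real.sqrt_pos.2 (Nat.cast_pos.2 x.pos)).ne'
  calc sphericalField U m v ξ x
      = 1 / √(N : ℝ) * (m * √(N : ℝ)) + inner ℝ (siteDirection U x)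
          (√((N : ℝ) * v) • NormedSpace.normalize (U ξ).snd) := hU.symm_apply _ x
    _ = _ := by
        rw [real_inner_smul_right, Real.sqrt_mul (Nat.cast_nonneg N)]
        field_simp

theorem IsMagnetizationFrame.apply_eq (hU : IsMagnetizationFrame U) (ξ : Config N) (x : Fin N) :
    ξ x = 1 / √(N : ℝ) * (U ξ).fst +
      ‖(U ξ).snd‖ * inner ℝ (siteDirection U x) (NormedSpace.normalize (U ξ).snd) := by
  rw [← real_inner_smul_right, NormedSpace.norm_smul_normalize, ← hU.symm_apply,
    U.symm_apply_apply]

end Fields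

section Comparison

variable {N : ℕ} {U : Config N ≃ₗᵢ[ℝ] Split N} {p : ENNReal}

theorem sqrt_natCast_le_sqrt_pred_add_one (N : ℕ) : √(N : ℝ) ≤ √((N - 1 : ℕ) : ℝ) + 1 := by
  have hN : (N : ℝ) ≤ (N - 1 : ℕ) + 1 := by exact_mod_cast Nat.le_add_of_sub_le le_rfl
  have hsq := Real.sq_sqrt (Nat.cast_nonneg (α := ℝ) (N - 1))
  exact Real.sqrt_le_iff.2 ⟨by positivity, by nlinarith [Real.sqrt_nonneg ((N - 1 : ℕ) : ℝ)]⟩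

theorem sqrt_mul_eLpNorm_inner_siteDirection_le (hN : 2 ≤ N) (U : Config N ≃ₗᵢ[ℝ] Split N)
    (x : Fin N) (hp : 2 ≤ p) (hp_top : p ≠ ⊤) :
    ENNReal.ofReal √(N : ℝ) * eLpNorm (fun y => inner ℝ (siteDirection U x)
      (NormedSpace.normalize y)) p (stdGaussian (EuclideanSpace ℝ (Fin (N - 1)))) ≤
        2 * gaussianLpNorm p := by
  have : Nonempty (Fin (N - 1)) := ⟨⟨0, by omega⟩⟩
  have hsqrt : √(N : ℝ) ≤ 2 * √((N - 1 : ℕ) : ℝ) := by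
    have hone : 1 ≤ √((N - 1 : ℕ) : ℝ) := Real.one_le_sqrt.2 (by exact_mod_cast (by omega))
    linarith [sqrt_natCast_le_sqrt_pred_add_one N]
  have hdirection := sqrt_finrank_mul_eLpNorm_inner_normalize_le (siteDirection U x) hp hp_top
  rw [finrank_euclideanSpace_fin] at hdirection
  have henorm : ‖siteDirection U x‖ₑ ≤ 1 := by
    rw [← ofReal_norm]
    exact ENNReal.ofReal_le_one.2 (norm_siteDirection_le U x)
  calc _ ≤ ENNReal.ofReal (2 * √((N - 1 : ℕ) : ℝ)) * _ := by gcongr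
    _ ≤ 2 * (‖siteDirection U x‖ₑ * gaussianLpNorm p) := by
        rw [ENNReal.ofReal_mul zero_le_two, ENNReal.ofReal_ofNat, mul_assoc]
        gcongr
    _ ≤ 2 * gaussianLpNorm p := by
        gcongr
        exact mul_le_of_le_one_left' henorm

theorem eLpNorm_gaussianField_apply_le (m v : ℝ) (x : Fin N) (hp : 1 ≤ p) :
    eLpNorm (fun ξ => gaussianField m v ξ x) p (stdGaussian (Config N)) ≤
      ENNReal.ofReal |m| + ENNReal.ofReal √v * gaussianLpNorm p := by
  have hcoord : eLpNorm (fun ξ : Config N => ξ x) p (stdGaussian (Config N)) =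
      gaussianLpNorm p := by
    simpa [EuclideanSpace.inner_single_left, enorm_eq_nnnorm] using
      eLpNorm_inner_stdGaussian (EuclideanSpace.single x (1 : ℝ)) p
  simp only [gaussianField_apply]
  rw [← hcoord]
  exact eLpNorm_const_add_const_mul_le m (Real.sqrt_nonneg v) (by fun_prop) hp

theorem IsMagnetizationFrame.eLpNorm_sphericalField_apply_le (hU : IsMagnetizationFrame U)
    (hN : 2 ≤ N) (m v : ℝ) (x : Fin N) (hp : 2 ≤ p) (hp_top : p ≠ ⊤) :
    eLpNorm (fun ξ => sphericalField U m v ξ x) p (stdGaussian (Config N)) ≤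
      ENNReal.ofReal |m| + ENNReal.ofReal √v * (2 * gaussianLpNorm p) := by
  set direction : EuclideanSpace ℝ (Fin (N - 1)) → ℝ := fun y =>
    √(N : ℝ) * inner ℝ (siteDirection U x) (NormedSpace.normalize y)
  have hdirection : Measurable direction :=
    (measurable_const.inner measurable_normalize).const_mul _
  have hsnd := measurePreserving_snd_stdGaussian U
  simp only [hU.sphericalField_apply]
  refine (eLpNorm_const_add_const_mul_le m (Real.sqrt_nonneg v)
    (hdirection.comp hsnd.measurable).aestronglyMeasurable (one_le_two.trans hp)).trans ?_
  gcongr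
  rw [eLpNorm_comp_measurePreserving hdirection.aestronglyMeasurable hsnd]
  refine le_of_eq_of_le ?_ (sqrt_mul_eLpNorm_inner_siteDirection_le hN U x hp hp_top)
  rw [← Real.enorm_of_nonneg (Real.sqrt_nonneg _), ← eLpNorm_const_smul]
  rfl

theorem eLpNorm_sqrt_sub_norm_stdGaussian_le (hN : 2 ≤ N) :
    eLpNorm (fun y => √(N : ℝ) - ‖y‖) 2 (stdGaussian (EuclideanSpace ℝ (Fin (N - 1)))) ≤
      ENNReal.ofReal (gaussianSqStdDev + 1) := by
  have : Nonempty (Fin (N - 1)) := ⟨⟨0, by omega⟩⟩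
  have hmono : √((N - 1 : ℕ) : ℝ) ≤ √(N : ℝ) :=
    Real.sqrt_le_sqrt (Nat.cast_le.2 (Nat.sub_le N 1))
  have hgap : |√(N : ℝ) - √((N - 1 : ℕ) : ℝ)| ≤ 1 := by
    rw [abs_of_nonneg (sub_nonneg.2 hmono)]
    linarith [sqrt_natCast_le_sqrt_pred_add_one N]
  have hconcentration := eLpNorm_norm_sub_sqrt_finrank_stdGaussian_le
    (E := EuclideanSpace ℝ (Fin (N - 1)))
  rw [finrank_euclideanSpace_fin] at hconcentration
  calc eLpNorm (fun y => √(N : ℝ) - ‖y‖) 2 (stdGaussian (EuclideanSpace ℝ (Fin (N - 1))))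
      = eLpNorm ((fun _ => √((N - 1 : ℕ) : ℝ) - √(N : ℝ)) + fun y => ‖y‖ - √((N - 1 : ℕ) : ℝ)) 2
          (stdGaussian (EuclideanSpace ℝ (Fin (N - 1)))) := by
        rw [← eLpNorm_neg]
        congr 1 with y
        simp
    _ ≤ _ := eLpNorm_add_le (by fun_prop) (by fun_prop) one_le_two
    _ ≤ ENNReal.ofReal 1 + ENNReal.ofReal gaussianSqStdDev := by
        gcongr
        rw [eLpNorm_const _ two_ne_zero (NeZero.ne _), measure_univ, ENNReal.one_rpow, mul_one,
          Real.enorm_eq_ofReal_abs, abs_sub_comm]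
        gcongr
    _ = ENNReal.ofReal (gaussianSqStdDev + 1) := by
        rw [add_comm, ENNReal.ofReal_add gaussianSqStdDev_nonneg zero_le_one]

theorem sqrt_mul_eLpNorm_sqrt_sub_norm_mul_inner_normalize_le (hN : 2 ≤ N)
    (U : Config N ≃ₗᵢ[ℝ] Split N) (x : Fin N) :
    ENNReal.ofReal √(N : ℝ) * eLpNorm (fun y => (√(N : ℝ) - ‖y‖) * inner ℝ (siteDirection U x)
      (NormedSpace.normalize y)) 2 (stdGaussian (EuclideanSpace ℝ (Fin (N - 1)))) ≤
        ENNReal.ofReal (gaussianSqStdDev + 1) * (2 * gaussianLpNorm 2) := by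
  have : Nonempty (Fin (N - 1)) := ⟨⟨0, by omega⟩⟩
  have hradius : Measurable fun r : ℝ => √(N : ℝ) - r := by fun_prop
  have hinner : Measurable fun y => inner ℝ (siteDirection U x) y := by fun_prop
  have hindep := indepFun_norm_normalize_stdGaussian.comp hradius hinner
  calc _ = ENNReal.ofReal √(N : ℝ) * (_ * _) :=
        congrArg _ (eLpNorm_mul_of_indepFun (hradius.comp measurable_norm)
          (hinner.comp measurable_normalize) hindep two_ne_zero ENNReal.ofNat_ne_top)
    _ = _ * (ENNReal.ofReal √(N : ℝ) * _) := mul_left_comm ..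
    _ ≤ _ := mul_le_mul' (eLpNorm_sqrt_sub_norm_stdGaussian_le hN)
        (sqrt_mul_eLpNorm_inner_siteDirection_le hN U x le_rfl ENNReal.ofNat_ne_top)

theorem IsMagnetizationFrame.sqrt_mul_eLpNorm_sphericalField_sub_gaussianField_le
    (hU : IsMagnetizationFrame U) (hN : 2 ≤ N) (m v : ℝ) (x : Fin N) :
    ENNReal.ofReal √(N : ℝ) * eLpNorm (fun ξ => sphericalField U m v ξ x - gaussianField m v ξ x) 2
      (stdGaussian (Config N)) ≤ ENNReal.ofReal √v *
        (ENNReal.ofReal (gaussianSqStdDev + 1) * (2 * gaussianLpNorm 2) + gaussianLpNorm 2) := by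
  set radial : EuclideanSpace ℝ (Fin (N - 1)) → ℝ := fun y =>
    (√(N : ℝ) - ‖y‖) * inner ℝ (siteDirection U x) (NormedSpace.normalize y)
  have hradial : Measurable radial :=
    (by fun_prop : Measurable fun y : EuclideanSpace ℝ (Fin (N - 1)) => √(N : ℝ) - ‖y‖).mul
      (measurable_const.inner measurable_normalize)
  have hsnd := measurePreserving_snd_stdGaussian U
  have hdecomposition : (fun ξ => sphericalField U m v ξ x - gaussianField m v ξ x) =
      √v • (radial ∘ (fun ξ => (U ξ).snd) - (√(N : ℝ))⁻¹ • fun ξ => (U ξ).fst) := by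
    ext ξ
    rw [hU.sphericalField_apply, gaussianField_apply, hU.apply_eq ξ x]
    simp only [radial, Pi.smul_apply, Pi.sub_apply, Function.comp_apply, smul_eq_mul]
    ring
  have hN_pos : 0 < √(N : ℝ) := Real.sqrt_pos.2 (Nat.cast_pos.2 x.pos)
  have hcancel : ENNReal.ofReal √(N : ℝ) * ENNReal.ofReal (√(N : ℝ))⁻¹ = 1 := by
    rw [← ENNReal.ofReal_mul hN_pos.le, mul_inv_cancel₀ hN_pos.ne', ENNReal.ofReal_one]
  rw [hdecomposition, eLpNorm_const_smul, Real.enorm_of_nonneg (Real.sqrt_nonneg v), mul_left_comm]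
  gcongr
  calc _ ≤ ENNReal.ofReal √(N : ℝ) * (eLpNorm (radial ∘ fun ξ => (U ξ).snd) 2 (stdGaussian _) +
          eLpNorm ((√(N : ℝ))⁻¹ • fun ξ => (U ξ).fst) 2 (stdGaussian _)) := by
        gcongr
        exact eLpNorm_sub_le (hradial.comp hsnd.measurable).aestronglyMeasurable
          (by fun_prop) one_le_two
    _ = ENNReal.ofReal √(N : ℝ) * eLpNorm radial 2 (stdGaussian _) + gaussianLpNorm 2 := by
        rw [eLpNorm_comp_measurePreserving hradial.aestronglyMeasurable hsnd, eLpNorm_const_smul,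
          eLpNorm_fst_stdGaussian, Real.enorm_of_nonneg (by positivity), mul_add, ← mul_assoc,
          hcancel, one_mul]
    _ ≤ _ := add_le_add_left
        (sqrt_mul_eLpNorm_sqrt_sub_norm_mul_inner_normalize_le hN U x) _

end Comparison

/-- `f` is Lipschitz up to a polynomial weight: the constant on balls of radius `R` is of order
`L * R ^ q`. This class of observables contains Lipschitz functions and is closed under products. -/
def PolynomiallyLipschitzWith {F : Type*} [NormedAddCommGroup F] (L : NNReal) (q : ℕ)
    (f : F → ℝ) : Prop :=
  ∀ a b, |f a - f b| ≤ L * (1 + ‖a‖ + ‖b‖) ^ q * ‖a - b‖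

section PolynomiallyLipschitz

variable {F : Type*} [NormedAddCommGroup F] {f g : F → ℝ} {L M : NNReal} {q r : ℕ}

namespace PolynomiallyLipschitzWith

theorem of_lipschitzWith (hf : LipschitzWith L f) : PolynomiallyLipschitzWith L 0 f :=
  fun a b => by simpa [Real.dist_eq, dist_eq_norm] using hf.dist_le_mul a b

theorem const (c : ℝ) : PolynomiallyLipschitzWith 0 0 fun _ : F => c := fun a b => by
  simp

theorem abs_le (hf : PolynomiallyLipschitzWith L q f) (a : F) :
    |f a| ≤ (|f 0| + L) * (1 + ‖a‖) ^ (q + 1) := by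
  have htriangle : |f a| ≤ |f 0| + |f a - f 0| := by
    simpa using abs_add_le (f 0) (f a - f 0)
  have hincrement : |f a - f 0| ≤ L * (1 + ‖a‖) ^ q * ‖a‖ := by
    simpa using hf a 0
  have hone : 1 ≤ (1 + ‖a‖) ^ (q + 1) := one_le_pow₀ (by simp)
  calc |f a| ≤ |f 0| + L * (1 + ‖a‖) ^ q * ‖a‖ := by linarith
    _ ≤ |f 0| * (1 + ‖a‖) ^ (q + 1) + L * (1 + ‖a‖) ^ q * (1 + ‖a‖) := by
        gcongr
        · exact le_mul_of_one_le_right (abs_nonneg _) hone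
        · simp
    _ = (|f 0| + L) * (1 + ‖a‖) ^ (q + 1) := by ring

theorem mul (hf : PolynomiallyLipschitzWith L q f) (hg : PolynomiallyLipschitzWith M r g) :
    PolynomiallyLipschitzWith ((‖f 0‖₊ + L) * M + (‖g 0‖₊ + M) * L) (q + r + 1)
      fun x => f x * g x := fun a b => by
  set T := 1 + ‖a‖ + ‖b‖ with hT
  have hfa : |f a| ≤ (|f 0| + L) * T ^ (q + 1) := (hf.abs_le a).trans (by gcongr; simp [hT])
  have hgb : |g b| ≤ (|g 0| + M) * T ^ (r + 1) := (hg.abs_le b).trans (by gcongr; simp [hT])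
  calc |f a * g a - f b * g b| = |f a * (g a - g b) + g b * (f a - f b)| := by ring_nf
    _ ≤ |f a| * |g a - g b| + |g b| * |f a - f b| := by
        simpa only [abs_mul] using abs_add_le (f a * (g a - g b)) (g b * (f a - f b))
    _ ≤ (|f 0| + L) * T ^ (q + 1) * (M * T ^ r * ‖a - b‖) +
        (|g 0| + M) * T ^ (r + 1) * (L * T ^ q * ‖a - b‖) := by
        gcongr
        exacts [hg a b, hf a b]
    _ = _ := by
        push_cast [Real.norm_eq_abs]
        ring

theorem exists_pow (hf : PolynomiallyLipschitzWith L q f) (k : ℕ) :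
    ∃ L' q', PolynomiallyLipschitzWith L' q' fun x => f x ^ k := by
  induction k with
  | zero => exact ⟨0, 0, by simpa using const 1⟩
  | succ k ih =>
    obtain ⟨L', q', ih⟩ := ih
    exact ⟨_, _, by simpa only [pow_succ] using ih.mul hf⟩

theorem exists_prod {ι : Type*} {f : ι → F → ℝ} (s : Finset ι)
    (hf : ∀ i, ∃ L q, PolynomiallyLipschitzWith L q (f i)) :
    ∃ L q, PolynomiallyLipschitzWith L q fun x => ∏ i ∈ s, f i x := by
  classical
  induction s using Finset.induction_on with
  | empty => exact ⟨0, 0, by simpa using const 1⟩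
  | insert i s hi ih =>
    obtain ⟨L, q, hfi⟩ := hf i
    obtain ⟨M, r, ih⟩ := ih
    exact ⟨_, _, by simpa only [Finset.prod_insert hi] using hfi.mul ih⟩

theorem continuous (hf : PolynomiallyLipschitzWith L q f) : Continuous f := by
  refine continuous_iff_continuousAt.2 fun b => tendsto_iff_norm_sub_tendsto_zero.2 ?_
  have hbound : Filter.Tendsto (fun a => L * (1 + ‖a‖ + ‖b‖) ^ q * ‖a - b‖) (nhds b) (nhds 0) := by
    have hcont : Continuous fun a => L * (1 + ‖a‖ + ‖b‖) ^ q * ‖a - b‖ := by fun_prop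
    simpa using hcont.tendsto b
  exact squeeze_zero (fun _ => norm_nonneg _) (fun a => hf a b) hbound

theorem exists_of_isBoundedLipschitz_or_isMoment {n : ℕ}
    {f : EuclideanSpace ℝ (Fin n) → ℝ} (hf : IsBoundedLipschitz f ∨ IsMoment f) :
    ∃ L q, PolynomiallyLipschitzWith L q f := by
  obtain ⟨-, hlip⟩ | ⟨k, hk⟩ := hf
  · exact ⟨1, 0, of_lipschitzWith hlip⟩
  · obtain rfl : f = fun y => ∏ i, y i ^ k i := funext hk
    have hcoord (i : Fin n) : LipschitzWith 1 fun y : EuclideanSpace ℝ (Fin n) => y i :=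
      LipschitzWith.of_dist_le_mul fun a b => by
        simpa [dist_eq_norm] using PiLp.norm_apply_le (a - b) i
    exact exists_prod _ fun i =>
      (of_lipschitzWith (hcoord i)).exists_pow (k i)

end PolynomiallyLipschitzWith

end PolynomiallyLipschitz

section PolynomialMoments

variable {Ω F : Type*} {mΩ : MeasurableSpace Ω} {P : Measure Ω}
  [NormedAddCommGroup F] {V W : Ω → F}

theorem eLpNorm_norm_pow (V : Ω → F) (p : ENNReal) {k : ℕ} (hk : k ≠ 0) :
    eLpNorm (fun ω => ‖V ω‖ ^ k) p P = eLpNorm V (p * k) P ^ k := by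
  simpa using eLpNorm_norm_rpow (μ := P) (p := p) V (q := k) (by positivity)

theorem eLpNorm_one_add_norm_add_norm_le [IsProbabilityMeasure P]
    (hV : AEStronglyMeasurable V P) (hW : AEStronglyMeasurable W P) {p : ENNReal} (hp : 1 ≤ p) :
    eLpNorm (fun ω => 1 + ‖V ω‖ + ‖W ω‖) p P ≤ 1 + eLpNorm V p P + eLpNorm W p P := by
  have hone : eLpNorm (fun _ => (1 : ℝ)) p P = 1 := by
    rw [eLpNorm_const _ (zero_lt_one.trans_le hp).ne' (NeZero.ne P)]
    simp
  calc eLpNorm (fun ω => 1 + ‖V ω‖ + ‖W ω‖) p P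
      ≤ eLpNorm (fun ω => 1 + ‖V ω‖) p P + eLpNorm (fun ω => ‖W ω‖) p P :=
        eLpNorm_add_le (f := fun ω => 1 + ‖V ω‖) (by fun_prop) (by fun_prop) hp
    _ ≤ eLpNorm (fun _ => (1 : ℝ)) p P + eLpNorm (fun ω => ‖V ω‖) p P +
        eLpNorm (fun ω => ‖W ω‖) p P := by
        gcongr
        exact eLpNorm_add_le (f := fun _ => (1 : ℝ)) (by fun_prop) (by fun_prop) hp
    _ = _ := by rw [hone, eLpNorm_norm, eLpNorm_norm]

namespace PolynomiallyLipschitzWith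

variable {f : F → ℝ} {L : NNReal} {q : ℕ}

theorem integrable_comp [IsFiniteMeasure P] (hf : PolynomiallyLipschitzWith L q f)
    (hV : MemLp V (q + 1 : ℕ) P) : Integrable (fun ω => f (V ω)) P := by
  have hgrowth : MemLp (fun ω => 1 + ‖V ω‖) (q + 1 : ℕ) P := (memLp_const (1 : ℝ)).add hV.norm
  refine (hgrowth.integrable_norm_pow'.const_mul (|f 0| + L)).mono'
    (hf.continuous.comp_aestronglyMeasurable hV.aestronglyMeasurable) (.of_forall fun ω => ?_)
  rw [Real.norm_of_nonneg (by positivity : 0 ≤ 1 + ‖V ω‖)]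
  exact hf.abs_le (V ω)

variable [IsProbabilityMeasure P]

theorem eLpNorm_comp_sub_comp_le (hf : PolynomiallyLipschitzWith L q f)
    (hV : AEStronglyMeasurable V P) (hW : AEStronglyMeasurable W P) :
    eLpNorm (fun ω => f (V ω) - f (W ω)) 1 P ≤
      L * ((1 + eLpNorm V (2 * (q + 1 : ℕ)) P + eLpNorm W (2 * (q + 1 : ℕ)) P) ^ (q + 1) *
        eLpNorm (fun ω => V ω - W ω) 2 P) := by
  set T : Ω → ℝ := fun ω => 1 + ‖V ω‖ + ‖W ω‖ with hT
  have hT_meas : AEStronglyMeasurable T P := by fun_prop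
  have hpointwise (ω : Ω) : ‖f (V ω) - f (W ω)‖ ≤ L * ‖‖T ω‖ ^ (q + 1) * ‖V ω - W ω‖‖ := by
    have hone : 1 ≤ T ω := by
      simp only [hT, add_assoc]
      exact le_add_of_nonneg_right (by positivity)
    rw [norm_mul, norm_pow, norm_norm, norm_norm, Real.norm_of_nonneg (zero_le_one.trans hone),
      ← mul_assoc]
    exact (hf _ _).trans (by gcongr; exact q.le_succ)
  have hp : (1 : ENNReal) ≤ 2 * (q + 1 : ℕ) := by exact_mod_cast (by omega : 1 ≤ 2 * (q + 1))
  calc eLpNorm (fun ω => f (V ω) - f (W ω)) 1 P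
      ≤ ENNReal.ofReal L * eLpNorm (fun ω => ‖T ω‖ ^ (q + 1) * ‖V ω - W ω‖) 1 P :=
        eLpNorm_le_mul_eLpNorm_of_ae_le_mul (.of_forall hpointwise) 1
    _ ≤ ENNReal.ofReal L * (eLpNorm (fun ω => ‖T ω‖ ^ (q + 1)) 2 P *
          eLpNorm (fun ω => ‖V ω - W ω‖) 2 P) := by
        gcongr
        exact eLpNorm_smul_le_mul_eLpNorm (φ := fun ω => ‖T ω‖ ^ (q + 1))
          (f := fun ω => ‖V ω - W ω‖) (by fun_prop) (by fun_prop)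
    _ ≤ _ := by
        rw [ENNReal.ofReal_coe_nnreal, eLpNorm_norm_pow _ _ q.succ_ne_zero, eLpNorm_norm]
        gcongr
        exact eLpNorm_one_add_norm_add_norm_le hV hW hp

theorem enorm_integral_comp_sub_le (hf : PolynomiallyLipschitzWith L q f)
    (hV : MemLp V (2 * (q + 1 : ℕ)) P) (hW : MemLp W (2 * (q + 1 : ℕ)) P) :
    ‖∫ ω, f (V ω) ∂P - ∫ ω, f (W ω) ∂P‖ₑ ≤
      L * ((1 + eLpNorm V (2 * (q + 1 : ℕ)) P + eLpNorm W (2 * (q + 1 : ℕ)) P) ^ (q + 1) *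
        eLpNorm (fun ω => V ω - W ω) 2 P) := by
  have hp : ((q + 1 : ℕ) : ENNReal) ≤ 2 * (q + 1 : ℕ) := le_mul_of_one_le_left' one_le_two
  rw [← integral_sub (hf.integrable_comp (hV.mono_exponent hp))
    (hf.integrable_comp (hW.mono_exponent hp))]
  refine (enorm_integral_le_lintegral_enorm _).trans ?_
  rw [← eLpNorm_one_eq_lintegral_enorm]
  exact hf.eLpNorm_comp_sub_comp_le hV.1 hW.1

end PolynomiallyLipschitzWith

end PolynomialMoments

section Marginals

variable {N n : ℕ} {I : Finset (Fin N)} {hI : I.card = n}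

theorem measurable_proj : Measurable (proj I hI) := by
  unfold proj
  fun_prop

theorem eLpNorm_proj_le {Ω : Type*} {mΩ : MeasurableSpace Ω} {P : Measure Ω} {V : Ω → Config N}
    (hV : Measurable V) {p : ENNReal} (hp : 1 ≤ p) {b : ENNReal}
    (hb : ∀ x, eLpNorm (fun ω => V ω x) p P ≤ b) :
    eLpNorm (fun ω => proj I hI (V ω)) p P ≤ n * b :=
  calc eLpNorm (fun ω => proj I hI (V ω)) p P
      ≤ ∑ j, eLpNorm (fun ω => V ω (I.orderEmbOfFin hI j)) p P :=
        eLpNorm_euclideanSpace_le_sum (measurable_proj.comp hV).aestronglyMeasurable hp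
    _ ≤ ∑ _j : Fin n, b := Finset.sum_le_sum fun _ _ => hb _
    _ = n * b := by simp

/-- A bound, uniform in the volume, on the `Lᵖ` norms of the marginals on `n` sites of both
fields. -/
noncomputable def marginalLpBound (n : ℕ) (m v : ℝ) (p : ENNReal) : ENNReal :=
  n * (ENNReal.ofReal |m| + ENNReal.ofReal √v * (2 * gaussianLpNorm p))

/-- The constant in the bound of order `N^{-1/2}` on the mean square distance of the marginals of
both fields on `n` sites. -/
noncomputable def marginalDistBound (n : ℕ) (v : ℝ) : ENNReal :=
  n * (ENNReal.ofReal √v *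
    (ENNReal.ofReal (gaussianSqStdDev + 1) * (2 * gaussianLpNorm 2) + gaussianLpNorm 2))

theorem marginalLpBound_ne_top (n : ℕ) (m v : ℝ) {p : ENNReal} (hp : p ≠ ⊤) :
    marginalLpBound n m v p ≠ ⊤ := by
  have := gaussianLpNorm_ne_top hp
  unfold marginalLpBound
  finiteness

theorem marginalDistBound_ne_top (n : ℕ) (v : ℝ) : marginalDistBound n v ≠ ⊤ := by
  have := gaussianLpNorm_ne_top ENNReal.ofNat_ne_top (p := 2)
  unfold marginalDistBound
  finiteness

theorem eLpNorm_proj_gaussianField_le (m v : ℝ) {p : ENNReal} (hp : 1 ≤ p) :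
    eLpNorm (fun ξ => proj I hI (gaussianField m v ξ)) p (stdGaussian (Config N)) ≤
      marginalLpBound n m v p := by
  refine eLpNorm_proj_le (measurable_gaussianField m v) hp fun x =>
    (eLpNorm_gaussianField_apply_le m v x hp).trans ?_
  gcongr
  exact le_mul_of_one_le_left' one_le_two

variable {U : Config N ≃ₗᵢ[ℝ] Split N}

theorem IsMagnetizationFrame.eLpNorm_proj_sphericalField_le (hU : IsMagnetizationFrame U)
    (hN : 2 ≤ N) (m v : ℝ) {p : ENNReal} (hp : 2 ≤ p) (hp_top : p ≠ ⊤) :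
    eLpNorm (fun ξ => proj I hI (sphericalField U m v ξ)) p (stdGaussian (Config N)) ≤
      marginalLpBound n m v p :=
  eLpNorm_proj_le (measurable_sphericalField U m v) (one_le_two.trans hp) fun x =>
    hU.eLpNorm_sphericalField_apply_le hN m v x hp hp_top

theorem IsMagnetizationFrame.eLpNorm_proj_sphericalField_sub_le (hU : IsMagnetizationFrame U)
    (hN : 2 ≤ N) (m v : ℝ) :
    eLpNorm (fun ξ => proj I hI (sphericalField U m v ξ) - proj I hI (gaussianField m v ξ)) 2
      (stdGaussian (Config N)) ≤ marginalDistBound n v / ENNReal.ofReal √(N : ℝ) := by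
  have hsqrt : ENNReal.ofReal √(N : ℝ) ≠ 0 :=
    (ENNReal.ofReal_pos.2 (Real.sqrt_pos.2 (Nat.cast_pos.2 (by omega)))).ne'
  rw [marginalDistBound, mul_div_assoc]
  refine eLpNorm_proj_le
    (V := fun ξ => sphericalField U m v ξ - gaussianField m v ξ)
    ((measurable_sphericalField U m v).sub (measurable_gaussianField m v)) one_le_two fun x => ?_
  rw [ENNReal.le_div_iff_mul_le (.inl hsqrt) (.inl ENNReal.ofReal_ne_top), mul_comm]
  exact hU.sqrt_mul_eLpNorm_sphericalField_sub_gaussianField_le hN m v x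

theorem memLp_proj_gaussianField (m v : ℝ) {p : ENNReal} (hp : 1 ≤ p) (hp_top : p ≠ ⊤) :
    MemLp (fun ξ => proj I hI (gaussianField m v ξ)) p (stdGaussian (Config N)) :=
  ⟨(measurable_proj.comp (measurable_gaussianField m v)).aestronglyMeasurable,
    (eLpNorm_proj_gaussianField_le m v hp).trans_lt (marginalLpBound_ne_top n m v hp_top).lt_top⟩

theorem IsMagnetizationFrame.memLp_proj_sphericalField (hU : IsMagnetizationFrame U) (hN : 2 ≤ N)
    (m v : ℝ) {p : ENNReal} (hp : 2 ≤ p) (hp_top : p ≠ ⊤) :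
    MemLp (fun ξ => proj I hI (sphericalField U m v ξ)) p (stdGaussian (Config N)) :=
  ⟨(measurable_proj.comp (measurable_sphericalField U m v)).aestronglyMeasurable,
    (hU.eLpNorm_proj_sphericalField_le hN m v hp hp_top).trans_lt
      (marginalLpBound_ne_top n m v hp_top).lt_top⟩

end Marginals

section EnsembleComparison

variable {N n : ℕ} {U : Config N ≃ₗᵢ[ℝ] Split N} {L : NNReal} {q : ℕ}
  {f : EuclideanSpace ℝ (Fin n) → ℝ}

/-- The constant in the bound of order `N^{-1/2}` on the difference of the expectations of an
observable `f` of `n` sites with `PolynomiallyLipschitzWith L q f`. -/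
noncomputable def ensembleDistBound (n : ℕ) (m v : ℝ) (L : NNReal) (q : ℕ) : ENNReal :=
  L * ((1 + marginalLpBound n m v (2 * (q + 1 : ℕ)) + marginalLpBound n m v (2 * (q + 1 : ℕ))) ^
    (q + 1) * marginalDistBound n v)

theorem ensembleDistBound_ne_top (n : ℕ) (m v : ℝ) (L : NNReal) (q : ℕ) :
    ensembleDistBound n m v L q ≠ ⊤ := by
  have := marginalLpBound_ne_top n m v (p := 2 * (q + 1 : ℕ)) (by finiteness)
  have := marginalDistBound_ne_top n v
  unfold ensembleDistBound
  finiteness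

theorem IsMagnetizationFrame.enorm_integral_proj_sphericalField_sub_le
    (hU : IsMagnetizationFrame U) (hN : 2 ≤ N) (m v : ℝ) (hf : PolynomiallyLipschitzWith L q f)
    (I : Finset (Fin N)) (hI : I.card = n) :
    ‖∫ ξ, f (proj I hI (sphericalField U m v ξ)) ∂stdGaussian (Config N) -
        ∫ ξ, f (proj I hI (gaussianField m v ξ)) ∂stdGaussian (Config N)‖ₑ ≤
      ensembleDistBound n m v L q / ENNReal.ofReal √(N : ℝ) := by
  have hp : (2 : ENNReal) ≤ 2 * (q + 1 : ℕ) := by exact_mod_cast (by omega : 2 ≤ 2 * (q + 1))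
  have hp_top : (2 * (q + 1 : ℕ) : ENNReal) ≠ ⊤ := by finiteness
  refine (hf.enorm_integral_comp_sub_le (hU.memLp_proj_sphericalField hN m v hp hp_top)
    (memLp_proj_gaussianField m v (one_le_two.trans hp) hp_top)).trans ?_
  rw [ensembleDistBound, mul_div_assoc, mul_div_assoc]
  gcongr
  · exact hU.eLpNorm_proj_sphericalField_le hN m v hp hp_top
  · exact eLpNorm_proj_gaussianField_le m v (one_le_two.trans hp)
  · exact hU.eLpNorm_proj_sphericalField_sub_le hN m v

theorem PolynomiallyLipschitzWith.measurable_comp_proj (hf : PolynomiallyLipschitzWith L q f)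
    (I : Finset (Fin N)) (hI : I.card = n) : Measurable fun φ => f (proj I hI φ) :=
  hf.continuous.measurable.comp measurable_proj

theorem IsMagnetizationFrame.integrable_proj_microcanonical (hU : IsMagnetizationFrame U)
    (hN : 2 ≤ N) (m ρ : ℝ) (hf : PolynomiallyLipschitzWith L q f) (I : Finset (Fin N))
    (hI : I.card = n) : Integrable (fun φ => f (proj I hI φ)) (microcanonical U m ρ) := by
  rw [← map_sphericalField_stdGaussian hN,
    integrable_map_measure (hf.measurable_comp_proj I hI).aestronglyMeasurable
      (measurable_sphericalField U m _).aemeasurable]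
  have hp : (2 : ENNReal) ≤ 2 * (q + 1 : ℕ) := by exact_mod_cast (by omega : 2 ≤ 2 * (q + 1))
  exact hf.integrable_comp ((hU.memLp_proj_sphericalField hN m _ hp (by finiteness)).mono_exponent
    (le_mul_of_one_le_left' one_le_two))

theorem integrable_proj_grandCanonical (m : ℝ) {v : ℝ} (hv : 0 < v)
    (hf : PolynomiallyLipschitzWith L q f) (I : Finset (Fin N)) (hI : I.card = n) :
    Integrable (fun φ => f (proj I hI φ)) (grandCanonical N (-(m / v)) (1 / (2 * v))) := by
  rw [← map_gaussianField_stdGaussian m hv,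
    integrable_map_measure (hf.measurable_comp_proj I hI).aestronglyMeasurable
      (measurable_gaussianField m v).aemeasurable]
  exact hf.integrable_comp (memLp_proj_gaussianField m v (by simp) (by finiteness))

theorem IsMagnetizationFrame.abs_integral_microcanonical_sub_grandCanonical_le
    (hU : IsMagnetizationFrame U) (hN : 2 ≤ N) {m ρ : ℝ} (hm : m ^ 2 < ρ)
    (hf : PolynomiallyLipschitzWith L q f) (I : Finset (Fin N)) (hI : I.card = n) :
    |(∫ φ, f (proj I hI φ) ∂microcanonical U m ρ) -
        ∫ φ, f (proj I hI φ) ∂grandCanonical N (-(m / (ρ - m ^ 2))) (1 / (2 * (ρ - m ^ 2)))| ≤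
      (ensembleDistBound n m (ρ - m ^ 2) L q).toReal * (N : ℝ) ^ (-(1 / 2) : ℝ) := by
  have hobs := hf.measurable_comp_proj I hI
  have hN_pos : 0 < √(N : ℝ) := Real.sqrt_pos.2 (Nat.cast_pos.2 (by omega))
  have hbound := hU.enorm_integral_proj_sphericalField_sub_le hN m (ρ - m ^ 2) hf I hI
  rw [← map_sphericalField_stdGaussian hN, ← map_gaussianField_stdGaussian m (sub_pos.2 hm),
    integral_map (measurable_sphericalField U m _).aemeasurable hobs.aestronglyMeasurable,
    integral_map (measurable_gaussianField m _).aemeasurable hobs.aestronglyMeasurable,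
    ← Real.norm_eq_abs, ← toReal_enorm, Real.rpow_neg N.cast_nonneg, ← Real.sqrt_eq_rpow,
    ← div_eq_mul_inv]
  refine (ENNReal.toReal_mono (ENNReal.div_ne_top (ensembleDistBound_ne_top n m _ L q)
    (ENNReal.ofReal_pos.2 hN_pos).ne') hbound).trans_eq ?_
  rw [ENNReal.toReal_div, ENNReal.toReal_ofReal hN_pos.le]

end EnsembleComparison

end SphericalModel

theorem mainTheorem9_general (ρ m μ η : ℝ) (hm : m ^ 2 < ρ) (hμ : μ = -(m / (ρ - m ^ 2)))
    (hη : η = 1 / (2 * (ρ - m ^ 2))) (n : ℕ) (f : EuclideanSpace ℝ (Fin n) → ℝ) (L : NNReal)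
    (q : ℕ) (hf : SphericalModel.PolynomiallyLipschitzWith L q f) :
    ∃ C : ℝ, ∀ N : ℕ, 2 ≤ N →
      ∀ U : SphericalModel.Config N ≃ₗᵢ[ℝ] SphericalModel.Split N,
        SphericalModel.IsMagnetizationFrame U →
      ∀ (I : Finset (Fin N)) (hI : I.card = n),
        Integrable (fun φ => f (SphericalModel.proj I hI φ))
          (SphericalModel.microcanonical U m ρ) ∧
        Integrable (fun φ => f (SphericalModel.proj I hI φ))
          (SphericalModel.grandCanonical N μ η) ∧
        |(∫ φ, f (SphericalModel.proj I hI φ) ∂SphericalModel.microcanonical U m ρ) -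
            ∫ φ, f (SphericalModel.proj I hI φ) ∂SphericalModel.grandCanonical N μ η|
          ≤ C * (N : ℝ) ^ (-(1 / 2) : ℝ) := by
  subst hμ hη
  exact ⟨_, fun N hN U hU I hI => ⟨hU.integrable_proj_microcanonical hN m ρ hf I hI,
    SphericalModel.integrable_proj_grandCanonical m (sub_pos.2 hm) hf I hI,
    hU.abs_integral_microcanonical_sub_grandCanonical_le hN hm hf I hI⟩⟩

theorem mainTheorem9 (ρ m μ η : ℝ) (hρ : 0 < ρ) (hm : m ∈ Set.Ioo (-√ρ) (√ρ))
    (hμ : μ = -(m / (ρ - m ^ 2))) (hη : η = 1 / (2 * (ρ - m ^ 2)))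
    (n : ℕ) (f : EuclideanSpace ℝ (Fin n) → ℝ)
    (hf : SphericalModel.IsBoundedLipschitz f ∨ SphericalModel.IsMoment f) :
    ∃ (C : ℝ) (N₀ : ℕ), ∀ N : ℕ, N₀ ≤ N →
      ∀ U : SphericalModel.Config N ≃ₗᵢ[ℝ] SphericalModel.Split N,
        SphericalModel.IsMagnetizationFrame U →
      ∀ (I : Finset (Fin N)) (hI : I.card = n),
        Integrable (fun φ => f (SphericalModel.proj I hI φ))
          (SphericalModel.microcanonical U m ρ) ∧
        Integrable (fun φ => f (SphericalModel.proj I hI φ))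
          (SphericalModel.grandCanonical N μ η) ∧
        |(∫ φ, f (SphericalModel.proj I hI φ) ∂SphericalModel.microcanonical U m ρ) -
            ∫ φ, f (SphericalModel.proj I hI φ) ∂SphericalModel.grandCanonical N μ η|
          ≤ C * (N : ℝ) ^ (-(1 / 2) : ℝ) := by
  obtain ⟨L, q, hf⟩ :=
    SphericalModel.PolynomiallyLipschitzWith.exists_of_isBoundedLipschitz_or_isMoment hf
  have hm_sq : m ^ 2 < ρ := Real.sq_lt.2 hm
  obtain ⟨C, hC⟩ := mainTheorem9_general ρ m μ η hm_sq hμ hη n f L q hf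
  exact ⟨C, 2, hC⟩
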